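/- Let $\mathbb K$ be an algebraically closed field of characteristic $0$, let $\mathfrak q$ be a finite-dimensional Lie algebra over $\mathbb K$, let $\vartheta$ be a Lie algebra automorphism of $\mathfrak q$ of finite order $m\ge 1$, and let $\zeta\in\mathbb K$ be a primitive $m$-th root of unity. For $0\le i<m$ let $\mathfrak q_i$ be the $\zeta^i$-eigenspace of $\vartheta$, so that $\mathfrak q=\bigoplus_{i=0}^{m-1}\mathfrak q_i$, and regard $\mathfrak q_0^*$ as the annihilator of $\mathfrak q_1\oplus\dots\oplus\mathfrak q_{m-1}$ in $\mathfrak q^*$. An element $\xi\in\mathfrak q^*$ is called regular if the dimension of its stabiliser $\mathfrak q^\xi=\{x\in\mathfrak q\mid \mathrm{ad}^*(x)\cdot\xi=0\}$ is minimal among all elements of $\mathfrak q^*$; let $\mathfrak q^*_{\sf reg}$ be the set of regular elements. Extend $\vartheta$ to the automorphism $\Theta$ of the loop algebra $\widehat{\mathfrak q}=\mathfrak q[t,t^{-1}]$ given by $\Theta(xt^k)=\zeta^k\vartheta(x)t^k$ for $x\in\mathfrak q$, $k\in\mathbb Z$, and let $\widehat{\mathfrak q}_+^\vartheta=\mathfrak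 q[t]^\Theta$ and $\mathfrak q[t^{-1}]^\vartheta=\mathfrak q[t^{-1}]^\Theta$ be the fixed-point subalgebras of $\mathfrak q[t]$ and $\mathfrak q[t^{-1}]$. Identifying $\widehat{\mathfrak q}_+^\vartheta$ with the quotient $(\mathfrak q[t,t^{-1}]/t^{-1}\mathfrak q[t^{-1}])^\Theta$, one obtains an action of $\mathfrak q[t^{-1}]^\vartheta$ on the vector space $\widehat{\mathfrak q}_+^\vartheta$, and hence, by derivations, on the symmetric algebra $\mathcal S(\widehat{\mathfrak q}_+^\vartheta)$. Let $$\mathcal Z(\widehat{\mathfrak q}^\vartheta,[0])=\mathcal S(\widehat{\mathfrak q}_+^\vartheta)^{\mathfrak q[t^{-1}]^\vartheta}$$ be the subalgebra of invariants, i.e. of the elements annihilated by all of $\mathfrak q[t^{-1}]^\vartheta$. Equip $\mathcal S(\widehat{\mathfrak q}_+^\vartheta)$ with the Poisson bracket that extends the Lie bracket of $\widehat{\mathfrak q}_+^\vartheta$. **Theorem.** If $\mathfrak q_0^*\cap\mathfrak q^*_{\sf reg}\neq\varnothing$, then $\mathcal Z(\widehat{\mathfrak q}^\vartheta,[0])$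 is a Poisson-commutative subalgebra of $\mathcal S(\widehat{\mathfrak q}_+^\vartheta)$: $\{F,G\}=0$ for all $F,G\in\mathcal Z(\widehat{\mathfrak q}^\vartheta,[0])$. -/

import Mathlib

open scoped TensorProduct

noncomputable section

namespace TwistedCurrent

section SymmetricAlgebra

variable {K : Type*} [CommRing K]

/-- The algebra homomorphism `S(M) → S(M) ⊕ ε S(M)` sending `x` to `x + ε f(x)`. -/
def dualLift {M : Type*} [AddCommGroup M] [Module K M] (f : M →ₗ[K] SymmetricAlgebra K M) :
    SymmetricAlgebra K M →ₐ[K]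
      TrivSqZeroExt (SymmetricAlgebra K M) (SymmetricAlgebra K M) :=
  SymmetricAlgebra.lift
    ((TrivSqZeroExt.inlAlgHom K (SymmetricAlgebra K M) (SymmetricAlgebra K M)).toLinearMap ∘ₗ
        SymmetricAlgebra.ι K M +
      (TrivSqZeroExt.inrHom (SymmetricAlgebra K M) (SymmetricAlgebra K M)).restrictScalars K ∘ₗ f)

theorem fst_dualLift {M : Type*} [AddCommGroup M] [Module K M]
    (f : M →ₗ[K] SymmetricAlgebra K M) (F : SymmetricAlgebra K M) :
    (dualLift f F).fst = F := by
  have h : (TrivSqZeroExt.fstHom K (SymmetricAlgebra K M) (SymmetricAlgebra K M)).comp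
      (dualLift f) = AlgHom.id K _ := by
    apply SymmetricAlgebra.algHom_ext
    ext x
    simp [dualLift]
  exact congrArg (fun φ => φ F) h

/-- The derivation of `S(M)` extending a linear map `f : M → S(M)`. -/
def extendDerivation {M : Type*} [AddCommGroup M] [Module K M]
    (f : M →ₗ[K] SymmetricAlgebra K M) :
    Derivation K (SymmetricAlgebra K M) (SymmetricAlgebra K M) where
  toFun F := (dualLift f F).snd
  map_add' F G := by simp
  map_smul' c F := by simp
  map_one_eq_zero' := by simp
  leibniz' F G := by
    simp [TrivSqZeroExt.snd_mul, fst_dualLift, mul_comm]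

@[simp]
theorem extendDerivation_ι {M : Type*} [AddCommGroup M] [Module K M]
    (f : M →ₗ[K] SymmetricAlgebra K M) (x : M) :
    extendDerivation f (SymmetricAlgebra.ι K M x) = f x := by
  change (dualLift f _).snd = _
  simp [dualLift]

theorem derivation_ext {M : Type*} [AddCommGroup M] [Module K M]
    {D E : Derivation K (SymmetricAlgebra K M) (SymmetricAlgebra K M)}
    (h : ∀ x : M, D (SymmetricAlgebra.ι K M x) = E (SymmetricAlgebra.ι K M x)) : D = E := by
  ext F
  induction F using SymmetricAlgebra.induction with
  | algebraMap r => simp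
  | ι x => exact h x
  | mul a b ha hb => simp [ha, hb]
  | add a b ha hb => simp [ha, hb]

variable {L : Type*} [LieRing L] [LieAlgebra K L]

/-- The action of `x ∈ L` on `S(L)` by the derivation extending `ad x`. -/
def adDerivation (x : L) : Derivation K (SymmetricAlgebra K L) (SymmetricAlgebra K L) :=
  extendDerivation (SymmetricAlgebra.ι K L ∘ₗ (LieAlgebra.ad K L x : L →ₗ[K] L))

theorem adDerivation_add (x y : L) :
    adDerivation (K := K) (x + y) = adDerivation x + adDerivation y :=
  derivation_ext fun z => by simp [adDerivation]

theorem adDerivation_smul (c : K) (x : L) :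
    adDerivation (K := K) (c • x) = c • adDerivation x :=
  derivation_ext fun z => by simp [adDerivation]

/-- The linear map `L → S(L)` sending `y` to `{F, y} = -(ad y)(F)`. -/
def hamiltonian (F : SymmetricAlgebra K L) : L →ₗ[K] SymmetricAlgebra K L where
  toFun y := -adDerivation y F
  map_add' x y := by simp [adDerivation_add, add_comm]
  map_smul' c x := by simp [adDerivation_smul]

/-- The Lie--Poisson bracket on `S(L)`: the bi-derivation with `{x, y} = [x, y]` on `L`
(see `poissonBracket_ι_ι`, `poissonBracket_mul_right`, `poissonBracket_skew`). -/
def poissonBracket (F G : SymmetricAlgebra K L) : SymmetricAlgebra K L :=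
  extendDerivation (hamiltonian F) G

theorem poissonBracket_ι_right (F : SymmetricAlgebra K L) (y : L) :
    poissonBracket F (SymmetricAlgebra.ι K L y) = -adDerivation y F := by
  simp [poissonBracket, hamiltonian]

theorem poissonBracket_ι_left (x : L) (G : SymmetricAlgebra K L) :
    poissonBracket (SymmetricAlgebra.ι K L x) G = adDerivation x G := by
  have h : extendDerivation (hamiltonian (SymmetricAlgebra.ι K L x)) = adDerivation x := by
    apply derivation_ext
    intro y
    simp [hamiltonian, adDerivation, ← map_neg]
  exact congrArg (fun D => D G) h

theorem poissonBracket_ι_ι (x y : L) :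
    poissonBracket (SymmetricAlgebra.ι K L x) (SymmetricAlgebra.ι K L y) =
      SymmetricAlgebra.ι K L ⁅x, y⁆ := by
  simp [poissonBracket_ι_left, adDerivation]

theorem poissonBracket_add_right (F G H : SymmetricAlgebra K L) :
    poissonBracket F (G + H) = poissonBracket F G + poissonBracket F H := by
  simp [poissonBracket]

theorem poissonBracket_mul_right (F G H : SymmetricAlgebra K L) :
    poissonBracket F (G * H) = G * poissonBracket F H + H * poissonBracket F G := by
  simp [poissonBracket]

theorem poissonBracket_skew (F G : SymmetricAlgebra K L) :
    poissonBracket F G = -poissonBracket G F := by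
  have hadd : ∀ A B H : SymmetricAlgebra K L,
      poissonBracket (A + B) H = poissonBracket A H + poissonBracket B H := by
    intro A B H
    have h : extendDerivation (hamiltonian (A + B)) =
        extendDerivation (hamiltonian A) + extendDerivation (hamiltonian B) :=
      derivation_ext fun z => by simp [hamiltonian, add_comm]
    exact congrArg (fun D => D H) h
  have hmul : ∀ A B H : SymmetricAlgebra K L,
      poissonBracket (A * B) H = A * poissonBracket B H + B * poissonBracket A H := by
    intro A B H
    have h : extendDerivation (hamiltonian (A * B)) =
        A • extendDerivation (hamiltonian B) + B • extendDerivation (hamiltonian A) :=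
      derivation_ext fun z => by simp [hamiltonian, add_comm]
    exact congrArg (fun D => D H) h
  induction F using SymmetricAlgebra.induction with
  | algebraMap r =>
    have h : extendDerivation (hamiltonian (algebraMap K (SymmetricAlgebra K L) r)) = 0 :=
      derivation_ext fun z => by simp [hamiltonian]
    have h' := congrArg (fun D => D G) h
    simp only [poissonBracket] at h' ⊢
    simp [h']
  | ι x => rw [poissonBracket_ι_left, poissonBracket_ι_right, neg_neg]
  | mul a b ha hb => rw [hmul, poissonBracket_mul_right, ha, hb]; ring
  | add a b ha hb => rw [hadd, poissonBracket_add_right, ha, hb]; ring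

end SymmetricAlgebra

section Regular

variable (K : Type*) [Field K] (L : Type*) [LieRing L] [LieAlgebra K L]

/-- The stabiliser of `ξ ∈ L^*` under the coadjoint action. -/
def coadjointStabilizer (ξ : Module.Dual K L) : Submodule K L where
  carrier := {x | ⁅x, ξ⁆ = 0}
  add_mem' {x y} hx hy := by
    change ⁅x + y, ξ⁆ = 0
    rw [add_lie, show ⁅x, ξ⁆ = 0 from hx, show ⁅y, ξ⁆ = 0 from hy, add_zero]
  zero_mem' := by simp
  smul_mem' c x hx := by
    change ⁅c • x, ξ⁆ = 0
    rw [smul_lie, show ⁅x, ξ⁆ = 0 from hx, smul_zero]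

/-- The index of a finite-dimensional Lie algebra: the minimal dimension of a stabiliser. -/
def lieIndex : ℕ := ⨅ ξ : Module.Dual K L, Module.finrank K (coadjointStabilizer K L ξ)

/-- The set of regular elements of `L^*`. -/
def regularDual : Set (Module.Dual K L) :=
  {ξ | Module.finrank K (coadjointStabilizer K L ξ) = lieIndex K L}

end Regular

section Loop

variable {K : Type*} [Field K] {q : Type*} [LieRing q] [LieAlgebra K q]

variable (K q) in
/-- The loop algebra `q[t, t⁻¹] = q ⊗ K[t, t⁻¹]`. -/
def Loop : Type _ := LieAlgebra.loopAlgebra K ℤ q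

instance : LieRing (Loop K q) := inferInstanceAs (LieRing (LieAlgebra.loopAlgebra K ℤ q))

instance : LieAlgebra K (Loop K q) :=
  inferInstanceAs (LieAlgebra K (LieAlgebra.loopAlgebra K ℤ q))

variable (K q) in
/-- The linear identification of `q[t, t⁻¹]` with finitely supported functions `ℤ → q`. -/
def toFinsupp : Loop K q ≃ₗ[K] (ℤ →₀ q) := LieAlgebra.LoopAlgebra.toFinsupp K ℤ q

/-- The coefficient `x_k ∈ q` of `t^k` in `∑ x_k t^k ∈ q[t, t⁻¹]`. -/
def coeff (k : ℤ) : Loop K q →ₗ[K] q :=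
  Finsupp.lapply k ∘ₗ (toFinsupp K q).toLinearMap

/-- The element `x t^k` of `q[t, t⁻¹]`. -/
def monomial (k : ℤ) (x : q) : Loop K q :=
  AddMonoidAlgebra.single k (1 : K) ⊗ₜ[K] x

theorem toFinsupp_monomial (k : ℤ) (x : q) :
    toFinsupp K q (monomial (K := K) k x) = Finsupp.single k x :=
  LieAlgebra.LoopAlgebra.toFinsupp_single_tmul K ℤ q k x

theorem coeff_monomial (n k : ℤ) (x : q) :
    coeff (K := K) n (monomial k x) = if k = n then x else 0 := by
  simp [coeff, toFinsupp_monomial, Finsupp.single_apply]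

theorem lie_monomial (k l : ℤ) (x y : q) :
    ⁅monomial (K := K) k x, monomial (K := K) l y⁆ = monomial (K := K) (k + l) ⁅x, y⁆ := by
  have h : (AddMonoidAlgebra.single k (1 : K) * AddMonoidAlgebra.single l (1 : K)) ⊗ₜ[K] ⁅x, y⁆ =
      AddMonoidAlgebra.single (k + l) (1 : K) ⊗ₜ[K] ⁅x, y⁆ := by
    rw [AddMonoidAlgebra.single_mul_single, one_mul]
  exact h

theorem eq_sum_monomial (f : Loop K q) :
    f = ∑ k ∈ (toFinsupp K q f).support, monomial k (coeff k f) := by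
  apply (toFinsupp K q).injective
  rw [map_sum]
  simp only [toFinsupp_monomial]
  exact (Finsupp.sum_single _).symm

@[ext]
theorem loop_ext {f g : Loop K q}
    (h : ∀ k, coeff k f = coeff k g) : f = g :=
  (toFinsupp K q).injective (Finsupp.ext h)

theorem coeff_lie (n : ℤ) (f g : Loop K q) :
    coeff n ⁅f, g⁆ =
      ∑ k ∈ (toFinsupp K q f).support,
        ∑ l ∈ (toFinsupp K q g).support,
          if k + l = n then ⁅coeff k f, coeff l g⁆ else 0 := by
  conv_lhs => rw [eq_sum_monomial f, eq_sum_monomial g]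
  simp only [_root_.sum_lie, _root_.lie_sum, lie_monomial, map_sum, coeff_monomial]
  exact Finset.sum_comm

variable (K q)

/-- The current algebra `q[t] ⊂ q[t, t⁻¹]`. -/
def currentPlus : LieSubalgebra K (Loop K q) where
  carrier := {f | ∀ k < 0, coeff k f = 0}
  add_mem' {f g} hf hg k hk := by simp [hf k hk, hg k hk]
  zero_mem' k hk := by simp
  smul_mem' c f hf k hk := by simp [hf k hk]
  lie_mem' {f g} hf hg n hn := by
    rw [coeff_lie]
    refine Finset.sum_eq_zero fun k _ => Finset.sum_eq_zero fun l _ => ?_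
    split_ifs with h
    · rcases lt_or_ge k 0 with hk | hk
      · simp [hf k hk]
      · simp [hg l (by omega)]
    · rfl

/-- The current algebra `q[t⁻¹] ⊂ q[t, t⁻¹]`. -/
def currentMinus : LieSubalgebra K (Loop K q) where
  carrier := {f | ∀ k > 0, coeff k f = 0}
  add_mem' {f g} hf hg k hk := by simp [hf k hk, hg k hk]
  zero_mem' k hk := by simp
  smul_mem' c f hf k hk := by simp [hf k hk]
  lie_mem' {f g} hf hg n hn := by
    rw [coeff_lie]
    refine Finset.sum_eq_zero fun k _ => Finset.sum_eq_zero fun l _ => ?_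
    split_ifs with h
    · rcases lt_or_ge 0 k with hk | hk
      · simp [hf k hk]
      · simp [hg l (by omega)]
    · rfl

/-- The projection of `q[t, t⁻¹] = t⁻¹q[t⁻¹] ⊕ q[t]` onto `q[t]` along `t⁻¹q[t⁻¹]`. -/
def projPlus : Loop K q →ₗ[K] Loop K q where
  toFun f := (toFinsupp K q).symm
    ((toFinsupp K q f).filter (fun k => 0 ≤ k))
  map_add' f g := by simp [Finsupp.filter_add]
  map_smul' c f := by simp [Finsupp.filter_smul]

theorem coeff_projPlus (k : ℤ) (f : Loop K q) :
    coeff k (projPlus K q f) = if 0 ≤ k then coeff k f else 0 := by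
  simp [coeff, projPlus, Finsupp.filter_apply]

variable {K q}

/-- The algebra endomorphism `t^k ↦ ζ^k t^k` of `K[t, t⁻¹]`. -/
def rotate (ζ : Kˣ) : AddMonoidAlgebra K ℤ →ₐ[K] AddMonoidAlgebra K ℤ :=
  AddMonoidAlgebra.lift K (AddMonoidAlgebra K ℤ) ℤ
    { toFun := fun k => AddMonoidAlgebra.single k.toAdd ((ζ ^ k.toAdd : Kˣ) : K)
      map_one' := by
        rw [toAdd_one, zpow_zero, Units.val_one, AddMonoidAlgebra.one_def]
      map_mul' := fun k l => by
        rw [AddMonoidAlgebra.single_mul_single, toAdd_mul, zpow_add, Units.val_mul] }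

/-- The extension `Θ` of `θ` to the loop algebra: `Θ(x t^k) = ζ^k θ(x) t^k`. -/
def loopAut (ζ : Kˣ) (θ : q ≃ₗ⁅K⁆ q) :
    Loop K q →ₗ⁅K⁆ Loop K q :=
  LieAlgebra.ExtendScalars.map (rotate ζ) (θ : q →ₗ⁅K⁆ q)

theorem loopAut_monomial (ζ : Kˣ) (θ : q ≃ₗ⁅K⁆ q) (k : ℤ) (x : q) :
    loopAut ζ θ (monomial k x) = monomial k (((ζ ^ k : Kˣ) : K) • θ x) := by
  have h : rotate ζ (AddMonoidAlgebra.single k (1 : K)) =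
      ((ζ ^ k : Kˣ) : K) • AddMonoidAlgebra.single k (1 : K) := by
    rw [rotate, AddMonoidAlgebra.lift_single, one_smul, AddMonoidAlgebra.smul_single,
      smul_eq_mul, mul_one]
    rfl
  change rotate ζ (AddMonoidAlgebra.single k (1 : K)) ⊗ₜ[K] θ x = _
  rw [h, monomial, TensorProduct.smul_tmul]

theorem coeff_loopAut (ζ : Kˣ) (θ : q ≃ₗ⁅K⁆ q) (k : ℤ) (f : Loop K q) :
    coeff k (loopAut ζ θ f) = ((ζ ^ k : Kˣ) : K) • θ (coeff k f) := by
  conv_lhs => rw [eq_sum_monomial f]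
  simp only [map_sum, loopAut_monomial, coeff_monomial]
  rw [Finset.sum_ite_eq']
  split_ifs with h
  · rfl
  · have h0 : coeff k f = 0 := by simpa [coeff] using h
    rw [h0, map_zero, smul_zero]

/-- The `θ`-twisted loop algebra `q[t, t⁻¹]^Θ`. -/
def twistedLoop (ζ : Kˣ) (θ : q ≃ₗ⁅K⁆ q) : LieSubalgebra K (Loop K q) where
  carrier := {f | loopAut ζ θ f = f}
  add_mem' {f g} hf hg := by
    change loopAut ζ θ (f + g) = f + g
    rw [map_add, show loopAut ζ θ f = f from hf, show loopAut ζ θ g = g from hg]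
  zero_mem' := map_zero _
  smul_mem' c f hf := by
    change loopAut ζ θ (c • f) = c • f
    rw [map_smul, show loopAut ζ θ f = f from hf]
  lie_mem' {f g} hf hg := by
    change loopAut ζ θ ⁅f, g⁆ = ⁅f, g⁆
    rw [LieHom.map_lie, show loopAut ζ θ f = f from hf, show loopAut ζ θ g = g from hg]

/-- `q[t]^Θ`. -/
def twistedPlus (ζ : Kˣ) (θ : q ≃ₗ⁅K⁆ q) : LieSubalgebra K (Loop K q) :=
  currentPlus K q ⊓ twistedLoop ζ θ

/-- `q[t⁻¹]^Θ`. -/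
def twistedMinus (ζ : Kˣ) (θ : q ≃ₗ⁅K⁆ q) : LieSubalgebra K (Loop K q) :=
  currentMinus K q ⊓ twistedLoop ζ θ

theorem projPlus_mem (ζ : Kˣ) (θ : q ≃ₗ⁅K⁆ q) {f : Loop K q}
    (hf : f ∈ twistedLoop ζ θ) : projPlus K q f ∈ twistedPlus ζ θ := by
  constructor
  · intro k hk
    rw [coeff_projPlus, if_neg (by omega)]
  · change loopAut ζ θ (projPlus K q f) = projPlus K q f
    apply loop_ext
    intro k
    rw [coeff_loopAut, coeff_projPlus]
    split_ifs with h
    · rw [← coeff_loopAut, show loopAut ζ θ f = f from hf]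
    · rw [map_zero, smul_zero]

/-- The action of `x ∈ q[t⁻¹]^Θ` on `q[t]^Θ`, the latter being identified with the quotient
`(q[t, t⁻¹] / t⁻¹q[t⁻¹])^Θ`: the bracket with `x`, followed by discarding the negative powers
of `t`. -/
def minusAction (ζ : Kˣ) (θ : q ≃ₗ⁅K⁆ q) (x : twistedMinus ζ θ) :
    twistedPlus ζ θ →ₗ[K] twistedPlus ζ θ where
  toFun y := ⟨projPlus K q ⁅(x : Loop K q), (y : Loop K q)⁆,
    projPlus_mem ζ θ ((twistedLoop ζ θ).lie_mem x.2.2 y.2.2)⟩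
  map_add' y z := by
    apply Subtype.ext
    simp
  map_smul' c y := by
    apply Subtype.ext
    simp

/-- `Z(q̂^θ, [0]) = S(q[t]^Θ)^{q[t⁻¹]^Θ}`: each `x ∈ q[t⁻¹]^Θ` acts on `S(q[t]^Θ)` by the derivation
extending its action on `q[t]^Θ`. -/
def twistedInvariants (ζ : Kˣ) (θ : q ≃ₗ⁅K⁆ q) :
    Subalgebra K (SymmetricAlgebra K (twistedPlus ζ θ)) where
  carrier := {F | ∀ x : twistedMinus ζ θ,
    extendDerivation (SymmetricAlgebra.ι K (twistedPlus ζ θ) ∘ₗ minusAction ζ θ x) F = 0}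
  mul_mem' {F G} hF hG x := by simp [hF x, hG x]
  add_mem' {F G} hF hG x := by simp [hF x, hG x]
  algebraMap_mem' c x := by simp

/-- `q_0^*`, regarded as the annihilator in `q^*` of `q_1 ⊕ ⋯ ⊕ q_{m-1}`, where `q_i` is the
`ζ^i`-eigenspace of `θ`. -/
def fixedDual (ζ : Kˣ) (m : ℕ) (θ : q ≃ₗ⁅K⁆ q) : Submodule K (Module.Dual K q) :=
  (⨆ i ∈ Finset.Ico 1 m,
    Module.End.eigenspace (θ.toLinearEquiv : q →ₗ[K] q) ((ζ : K) ^ i)).dualAnnihilator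

end Loop

end TwistedCurrent

end

/-! Elements of S(q[t]^Θ) are polynomial functions of a functional φ on q[t]^Θ. Let a, b be the
differentials at φ of two invariants F, G. Then {F,G}(φ) = φ([a,b]). Extend φ to the loop algebra by
averaging over Θ and discarding negative powers of t; invariance then says that φ kills [x,a] and
[x,b] for every x in q[t⁻¹].

Encode the extended φ as an arc φ_X = ∑ φ_i X^i in q^*, where φ_i is its restriction to q t^i. If N
bounds the degrees of a and b, the reversed polynomials ã = X^N a(X⁻¹) and b̃ satisfy φ_X([x,ã]) ≡
φ_X([x,b̃]) ≡ 0 mod X^(N+1) for x in q (`X_pow_dvd_sum`), while φ([a,b]) is the coefficient of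
X^(2N) in φ_X([ã,b̃]) (`coeff_sum_sum`). If some minor ([e_i,e_j]) of maximal size dim q - ind q is
nonzero at φ_0, it is a unit along the arc, and `det_bracketMatrix_mul` makes φ_X([ã,b̃]) a
combination of the products φ_X([e_i,ã]) φ_X([e_j,b̃]). These are divisible by X^(2N+2), so φ([a,b])
= 0 (`apply_lie_eq_zero`).

The constant term φ_0 can be any element of q_0^*, so a regular point there makes the minor a
nonzero polynomial Δ on the dual of q[t]^Θ. The product Δ {F,G} vanishes at every point, and
S(q[t]^Θ) is a domain. -/

noncomputable section

namespace TwistedCurrent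

/-! ### Symmetric algebras as polynomial functions on the dual -/

section SymmetricAlgebra

variable {K : Type*} [Field K]

/-- Over an infinite field an element of `S(M)` is determined by its values on `M^*`. -/
theorem eq_zero_of_forall_lift_eq_zero [Infinite K] {M : Type*} [AddCommGroup M] [Module K M]
    (F : SymmetricAlgebra K M)
    (h : ∀ φ : M →ₗ[K] K, SymmetricAlgebra.lift φ F = 0) : F = 0 := by
  obtain ⟨⟨κ, b⟩⟩ := Module.Free.exists_basis (R := K) (M := M)
  apply (SymmetricAlgebra.equivMvPolynomial b).injective
  rw [map_zero]
  apply MvPolynomial.funext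
  intro x
  rw [map_zero, ← h (b.constr K x)]
  have hc : ((MvPolynomial.aeval x).comp (SymmetricAlgebra.equivMvPolynomial b).toAlgHom :
      SymmetricAlgebra K M →ₐ[K] K) = SymmetricAlgebra.lift (b.constr K x) := by
    apply SymmetricAlgebra.algHom_ext
    apply b.ext
    intro i
    simp [SymmetricAlgebra.equivMvPolynomial_ι_apply]
  rw [← hc, ← MvPolynomial.coe_aeval_eq_eval]
  rfl

/-- The differential of `F ∈ S(M)` at the point `φ ∈ M^*`. -/
theorem exists_differential {M : Type*} [AddCommGroup M] [Module K M] (φ : M →ₗ[K] K)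
    (F : SymmetricAlgebra K M) :
    ∃ a : M, ∀ f : M →ₗ[K] SymmetricAlgebra K M,
      SymmetricAlgebra.lift φ (extendDerivation f F) = SymmetricAlgebra.lift φ (f a) := by
  induction F using SymmetricAlgebra.induction with
  | algebraMap r => exact ⟨0, fun f => by simp⟩
  | ι x => exact ⟨x, fun f => by simp⟩
  | mul F G hF hG =>
    obtain ⟨a, ha⟩ := hF
    obtain ⟨b, hb⟩ := hG
    exact ⟨SymmetricAlgebra.lift φ F • b + SymmetricAlgebra.lift φ G • a, fun f => by
      simp [ha, hb]⟩
  | add F G hF hG =>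
    obtain ⟨a, ha⟩ := hF
    obtain ⟨b, hb⟩ := hG
    exact ⟨a + b, fun f => by simp [ha, hb]⟩

end SymmetricAlgebra

/-! ### Stabilisers and minors of the form ξ([x,y]) -/

section Regular

variable {K : Type*} [Field K] {L : Type*} [LieRing L] [LieAlgebra K L]

theorem mem_coadjointStabilizer {ξ : Module.Dual K L} {x : L} :
    x ∈ coadjointStabilizer K L ξ ↔ ∀ y, ξ ⁅x, y⁆ = 0 := by
  change ⁅x, ξ⁆ = 0 ↔ _
  rw [LinearMap.ext_iff]
  simp

theorem lieIndex_le (ξ : Module.Dual K L) :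
    lieIndex K L ≤ Module.finrank K (coadjointStabilizer K L ξ) :=
  ciInf_le (OrderBot.bddBelow _) ξ

/-- The matrix `([e_i, e_j])` with entries in `S(L)`. -/
def bracketMatrix (K : Type*) [Field K] {L : Type*} [LieRing L] [LieAlgebra K L]
    {ι : Type*} (e : ι → L) : Matrix ι ι (SymmetricAlgebra K L) :=
  Matrix.of fun i j => SymmetricAlgebra.ι K L ⁅e i, e j⁆

/-- The target algebra is arbitrary because the same minor is evaluated at points of L^*, along arcs
in K⟦X⟧, and inside S(q[t]^Θ). -/
theorem lift_det_bracketMatrix {ι : Type*} [Fintype ι] [DecidableEq ι] (e : ι → L)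
    {R : Type*} [CommRing R] [Algebra K R] (ξ : L →ₗ[K] R) :
    SymmetricAlgebra.lift ξ (bracketMatrix K e).det =
      (Matrix.of fun i j => ξ ⁅e i, e j⁆).det := by
  rw [AlgHom.map_det]
  congr 1
  ext i j
  simp [bracketMatrix]

/-- The stabiliser is the kernel of the form ξ([x,y]), so the form is nondegenerate on any
complement; a basis of a complement gives the minor. -/
theorem exists_det_ne_zero [FiniteDimensional K L] (ξ : Module.Dual K L) :
    ∃ (r : ℕ) (e : Fin r → L),
      r + Module.finrank K (coadjointStabilizer K L ξ) = Module.finrank K L ∧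
      (Matrix.of fun i j => ξ ⁅e i, e j⁆).det ≠ 0 := by
  obtain ⟨W, hW⟩ := Submodule.exists_isCompl (coadjointStabilizer K L ξ)
  let b := Module.finBasis K W
  refine ⟨Module.finrank K W, fun i => (b i : L), ?_, fun hdet => ?_⟩
  · rw [add_comm]
    exact Submodule.finrank_add_eq_of_isCompl hW
  obtain ⟨c, hc, hAc⟩ := Matrix.exists_mulVec_eq_zero_iff.mpr hdet
  let w : W := ∑ i, c i • b i
  -- A null vector of the matrix is orthogonal to W, and the stabiliser is orthogonal to everything,
  -- so `w` lies in the kernel of the form and in W.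
  have hw : ∀ y : L, ξ ⁅y, (w : L)⁆ = 0 := by
    intro y
    have hy : y ∈ coadjointStabilizer K L ξ ⊔ W := by rw [hW.sup_eq_top]; trivial
    obtain ⟨z, hz, u, hu, rfl⟩ := Submodule.mem_sup.mp hy
    rw [add_lie, map_add, mem_coadjointStabilizer.mp hz, zero_add]
    have : ∀ u : W, ξ ⁅(u : L), (w : L)⁆ = 0 := by
      intro u
      rw [← b.sum_repr u]
      simp only [Submodule.coe_sum, Submodule.coe_smul, sum_lie, map_sum, smul_lie, map_smul]
      refine Finset.sum_eq_zero fun i _ => ?_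
      have := congrFun hAc i
      simp only [Matrix.mulVec, dotProduct, Matrix.of_apply, Pi.zero_apply] at this
      simp only [w, Submodule.coe_sum, Submodule.coe_smul, lie_sum, map_sum, lie_smul, map_smul,
        smul_eq_mul]
      simp only [mul_comm (c _), this, mul_zero]
    exact this ⟨u, hu⟩
  have hw0 : w = 0 := by
    have hmem : (w : L) ∈ coadjointStabilizer K L ξ := by
      rw [mem_coadjointStabilizer]
      intro y
      rw [← lie_skew, map_neg, hw, neg_zero]
    exact Subtype.ext (Submodule.disjoint_def.mp hW.disjoint _ hmem w.2)
  exact hc (funext fun i =>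
    Fintype.linearIndependent_iff.mp b.linearIndependent c hw0 i)

/-- By dimension, L is the direct sum of the span of the e_i and the stabiliser. Both sides are
linear in x and vanish on the stabiliser; at x = e_i the identity is A · adj A = det A. -/
theorem det_mul_eq_of_finrank_le [FiniteDimensional K L] (ξ : Module.Dual K L)
    {ι : Type*} [Fintype ι] [DecidableEq ι] (e : ι → L)
    (hdet : (Matrix.of fun i j => ξ ⁅e i, e j⁆).det ≠ 0)
    (hrank : Module.finrank K L ≤ Fintype.card ι + Module.finrank K (coadjointStabilizer K L ξ))
    (x y : L) :
    (Matrix.of fun i j => ξ ⁅e i, e j⁆).det * ξ ⁅x, y⁆ =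
      ∑ k, ∑ l, ξ ⁅x, e k⁆ * (Matrix.of fun i j => ξ ⁅e i, e j⁆).adjugate k l * ξ ⁅e l, y⁆ := by
  set A : Matrix ι ι K := Matrix.of fun i j => ξ ⁅e i, e j⁆ with hA
  have hcomb : ∀ c : ι → K, ∑ i, c i • e i ∈ coadjointStabilizer K L ξ → c = 0 := by
    intro c hc
    by_contra hne
    refine hdet (Matrix.exists_vecMul_eq_zero_iff.mp ⟨c, hne, ?_⟩)
    ext j
    have := mem_coadjointStabilizer.mp hc (e j)
    simpa [Matrix.vecMul, dotProduct, hA, sum_lie] using this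
  have hli : LinearIndependent K e := by
    rw [Fintype.linearIndependent_iff]
    intro c hc
    exact congrFun (hcomb c (hc ▸ zero_mem _))
  have hdisj : Submodule.span K (Set.range e) ⊓ coadjointStabilizer K L ξ = ⊥ := by
    rw [eq_bot_iff]
    rintro w ⟨hw, hw'⟩
    obtain ⟨c, rfl⟩ := (Submodule.mem_span_range_iff_exists_fun K).mp hw
    rw [hcomb c hw']
    simp
  have htop : Submodule.span K (Set.range e) ⊔ coadjointStabilizer K L ξ = ⊤ := by
    apply Submodule.eq_top_of_finrank_eq
    apply le_antisymm (Submodule.finrank_le _)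
    have h := Submodule.finrank_sup_add_finrank_inf_eq (Submodule.span K (Set.range e))
      (coadjointStabilizer K L ξ)
    rw [hdisj, finrank_bot, finrank_span_eq_card hli] at h
    omega
  have hx : x ∈ Submodule.span K (Set.range e) ⊔ coadjointStabilizer K L ξ := by
    rw [htop]; trivial
  obtain ⟨w, hw, z, hz, rfl⟩ := Submodule.mem_sup.mp hx
  obtain ⟨c, rfl⟩ := (Submodule.mem_span_range_iff_exists_fun K).mp hw
  have hz' := mem_coadjointStabilizer.mp hz
  have hrow : ∀ i l, ∑ k, ξ ⁅e i, e k⁆ * A.adjugate k l = if i = l then A.det else 0 := by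
    intro i l
    have := congrFun (congrFun (Matrix.mul_adjugate A) i) l
    simpa [Matrix.mul_apply, hA, Matrix.smul_apply, Matrix.one_apply] using this
  simp only [add_lie, sum_lie, smul_lie, map_add, map_sum, map_smul, hz', add_zero, smul_eq_mul]
  rw [Finset.sum_comm, Finset.mul_sum]
  simp only [← Finset.sum_mul]
  have hcoef : ∀ l, ∑ k, (∑ i, c i * ξ ⁅e i, e k⁆) * A.adjugate k l = c l * A.det := by
    intro l
    simp only [Finset.sum_mul, mul_assoc]
    rw [Finset.sum_comm]
    simp only [← Finset.mul_sum, hrow]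
    simp
  refine Finset.sum_congr rfl fun l _ => ?_
  rw [hcoef]
  ring

/-- Maximality of the rank of the coadjoint form at regular points, as an identity in `S(L)`. -/
theorem det_bracketMatrix_mul [Infinite K] [FiniteDimensional K L] {ι : Type*} [Fintype ι]
    [DecidableEq ι] (e : ι → L) (hcard : Fintype.card ι + lieIndex K L = Module.finrank K L)
    (h0 : (bracketMatrix K e).det ≠ 0) (x y : L) :
    (bracketMatrix K e).det * SymmetricAlgebra.ι K L ⁅x, y⁆ =
      ∑ k, ∑ l, SymmetricAlgebra.ι K L ⁅x, e k⁆ * (bracketMatrix K e).adjugate k l *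
        SymmetricAlgebra.ι K L ⁅e l, y⁆ := by
  -- The additional factor makes the identity trivial at points where the minor vanishes; at the
  -- others the stabiliser has the least possible dimension.
  apply mul_left_cancel₀ h0
  rw [← sub_eq_zero]
  apply eq_zero_of_forall_lift_eq_zero
  intro ξ
  have hmap : (SymmetricAlgebra.lift ξ).mapMatrix (bracketMatrix K e) =
      Matrix.of fun i j => ξ ⁅e i, e j⁆ := by
    ext i j
    simp [bracketMatrix]
  have hadj : ∀ k l, SymmetricAlgebra.lift ξ ((bracketMatrix K e).adjugate k l) =
      (Matrix.of fun i j => ξ ⁅e i, e j⁆).adjugate k l := by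
    intro k l
    rw [← hmap, ← AlgHom.map_adjugate]
    rfl
  simp only [map_sub, map_mul, map_sum, lift_det_bracketMatrix, SymmetricAlgebra.lift_ι_apply,
    hadj]
  by_cases hdet : (Matrix.of fun i j => ξ ⁅e i, e j⁆).det = 0
  · rw [hdet]; ring
  · rw [det_mul_eq_of_finrank_le ξ e hdet (by have := lieIndex_le ξ; omega), sub_self]

end Regular

/-! ### Arcs in the dual and the vanishing argument -/

section Loop

variable {K : Type*} [Field K] {q : Type*} [LieRing q] [LieAlgebra K q]

theorem monomial_add (k : ℤ) (x y : q) :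
    monomial (K := K) k (x + y) = monomial k x + monomial k y :=
  TensorProduct.tmul_add _ _ _

theorem monomial_smul (k : ℤ) (c : K) (x : q) :
    monomial (K := K) k (c • x) = c • monomial k x :=
  TensorProduct.tmul_smul _ _ _

/-- The map `q → K⟦X⟧` attached to a functional on `q[t, t⁻¹]`, whose `i`-th coefficient is the
restriction of the functional to `q t^i`. -/
def arc (φ : Loop K q →ₗ[K] K) : q →ₗ[K] PowerSeries K where
  toFun x := PowerSeries.mk fun i => φ (monomial (i : ℤ) x)
  map_add' x y := by
    ext i
    simp [monomial_add]
  map_smul' c x := by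
    ext i
    simp [monomial_smul]

theorem coeff_arc (φ : Loop K q →ₗ[K] K) (i : ℕ) (x : q) :
    PowerSeries.coeff i (arc φ x) = φ (monomial (i : ℤ) x) := by
  simp [arc]

theorem exists_eq_sum_range_monomial {a : Loop K q} (ha : a ∈ currentPlus K q) :
    ∃ N : ℕ, ∀ n, N ≤ n →
      a = ∑ k ∈ Finset.range (n + 1), monomial (k : ℤ) (coeff (k : ℤ) a) := by
  obtain ⟨N, hN⟩ := ((toFinsupp K q a).support.image Int.natAbs).bddAbove
  refine ⟨N, fun n hn => loop_ext fun j => ?_⟩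
  simp only [map_sum, coeff_monomial]
  rcases lt_or_ge j 0 with hj | hj
  · rw [ha j hj, Finset.sum_eq_zero]
    intro k _
    rw [if_neg (by omega)]
  lift j to ℕ using hj
  simp only [Nat.cast_inj, Finset.sum_ite_eq', Finset.mem_range]
  split_ifs with h
  · rfl
  · by_contra h0
    have : j ∈ (toFinsupp K q a).support.image Int.natAbs :=
      Finset.mem_image.mpr ⟨(j : ℤ), Finsupp.mem_support_iff.mpr h0, by simp⟩
    have := hN this
    omega

/-- The power series `X^N a(X⁻¹)` paired with `x` through the bracket. -/
theorem X_pow_dvd_sum (φ : Loop K q →ₗ[K] K) (hneg : ∀ k < 0, ∀ x, φ (monomial k x) = 0)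
    {a : Loop K q} {N : ℕ}
    (haN : a = ∑ k ∈ Finset.range (N + 1), monomial (k : ℤ) (coeff (k : ℤ) a))
    (hinv : ∀ x ∈ currentMinus K q, φ ⁅x, a⁆ = 0) (x : q) :
    (PowerSeries.X : PowerSeries K) ^ (N + 1) ∣
      ∑ k ∈ Finset.range (N + 1), PowerSeries.X ^ (N - k) * arc φ ⁅x, coeff (k : ℤ) a⁆ := by
  rw [PowerSeries.X_pow_dvd_iff]
  intro n hn
  -- The n-th coefficient is φ([x t^(n-N), a]), and n ≤ N puts x t^(n-N) in q[t⁻¹].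
  have hx : monomial ((n : ℤ) - N) x ∈ currentMinus K q := by
    intro k hk
    rw [coeff_monomial, if_neg (by omega)]
  rw [← hinv _ hx]
  conv_rhs => rw [haN]
  simp only [lie_sum, lie_monomial, map_sum, PowerSeries.coeff_X_pow_mul', coeff_arc]
  refine Finset.sum_congr rfl fun k hk => ?_
  rw [Finset.mem_range] at hk
  split_ifs with h
  · congr 2
    omega
  -- Terms with n < N - k are absent from the power series; in φ([x t^(n-N), a]) they sit in
  -- negative degree.
  · rw [hneg _ (by omega)]

/-- The (k,l) term is shifted by 2N - k - l, so the coefficient of X^(2N) reads φ in degree k + l.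
-/
theorem coeff_sum_sum (φ : Loop K q →ₗ[K] K) {a b : Loop K q} {N : ℕ}
    (haN : a = ∑ k ∈ Finset.range (N + 1), monomial (k : ℤ) (coeff (k : ℤ) a))
    (hbN : b = ∑ k ∈ Finset.range (N + 1), monomial (k : ℤ) (coeff (k : ℤ) b)) :
    PowerSeries.coeff (2 * N)
      (∑ k ∈ Finset.range (N + 1), ∑ l ∈ Finset.range (N + 1),
        PowerSeries.X ^ (N - k) * PowerSeries.X ^ (N - l) *
          arc φ ⁅coeff (k : ℤ) a, coeff (l : ℤ) b⁆) = φ ⁅a, b⁆ := by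
  conv_rhs => rw [haN, hbN]
  simp only [lie_sum, sum_lie, lie_monomial, map_sum, ← pow_add, PowerSeries.coeff_X_pow_mul',
    coeff_arc]
  rw [Finset.sum_comm]
  refine Finset.sum_congr rfl fun l hl => Finset.sum_congr rfl fun k hk => ?_
  rw [Finset.mem_range] at hk hl
  rw [if_pos (by omega)]
  congr 2
  omega

/-- A functional on `q[t]` whose constant coefficient is regular vanishes on brackets of elements
of `q[t]` that pair trivially with `q[t⁻¹]`. -/
theorem apply_lie_eq_zero [Infinite K] [FiniteDimensional K q]
    (φ : Loop K q →ₗ[K] K) (hneg : ∀ k < 0, ∀ x, φ (monomial k x) = 0)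
    {ι : Type*} [Fintype ι] [DecidableEq ι] (e : ι → q)
    (hcard : Fintype.card ι + lieIndex K q = Module.finrank K q)
    (hdet : (Matrix.of fun i j => φ (monomial 0 ⁅e i, e j⁆)).det ≠ 0)
    {a b : Loop K q} (ha : a ∈ currentPlus K q) (hb : b ∈ currentPlus K q)
    (hinva : ∀ x ∈ currentMinus K q, φ ⁅x, a⁆ = 0)
    (hinvb : ∀ x ∈ currentMinus K q, φ ⁅x, b⁆ = 0) : φ ⁅a, b⁆ = 0 := by
  obtain ⟨N₁, hN₁⟩ := exists_eq_sum_range_monomial ha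
  obtain ⟨N₂, hN₂⟩ := exists_eq_sum_range_monomial hb
  set N := max N₁ N₂
  have haN := hN₁ N (le_max_left _ _)
  have hbN := hN₂ N (le_max_right _ _)
  set D := SymmetricAlgebra.lift (arc φ) (bracketMatrix K e).det with hD
  -- The constant term of `D` is the minor at the constant term of the arc, nonzero by `hdet`.
  have hDunit : IsUnit D := by
    rw [PowerSeries.isUnit_iff_constantCoeff, isUnit_iff_ne_zero, hD, lift_det_bracketMatrix,
      RingHom.map_det]
    convert hdet using 2
    ext i j
    simp only [RingHom.mapMatrix_apply, Matrix.map_apply, Matrix.of_apply]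
    rw [← PowerSeries.coeff_zero_eq_constantCoeff_apply, coeff_arc]
    rfl
  have h0 : (bracketMatrix K e).det ≠ 0 := by
    intro h
    rw [hD, h, map_zero] at hDunit
    exact not_isUnit_zero hDunit
  let s := Finset.range (N + 1)
  let B : q → PowerSeries K := fun x =>
    ∑ k ∈ s, PowerSeries.X ^ (N - k) * arc φ ⁅x, coeff (k : ℤ) b⁆
  let A : q → PowerSeries K := fun x =>
    ∑ k ∈ s, PowerSeries.X ^ (N - k) * arc φ ⁅x, coeff (k : ℤ) a⁆
  have hA := X_pow_dvd_sum φ hneg haN hinva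
  have hB := X_pow_dvd_sum φ hneg hbN hinvb
  have key : D * ∑ k ∈ s, ∑ l ∈ s, PowerSeries.X ^ (N - k) * PowerSeries.X ^ (N - l) *
        arc φ ⁅coeff (k : ℤ) a, coeff (l : ℤ) b⁆ =
      ∑ i, ∑ j, -(A (e i) * SymmetricAlgebra.lift (arc φ) ((bracketMatrix K e).adjugate i j) *
        B (e j)) := by
    -- The sign comes from turning [x, e_i] into [e_i, x], so that both factors have the shape
    -- handled by `X_pow_dvd_sum`.
    have hid : ∀ x y, D * arc φ ⁅x, y⁆ = ∑ i, ∑ j, -(arc φ ⁅e i, x⁆ *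
        SymmetricAlgebra.lift (arc φ) ((bracketMatrix K e).adjugate i j) * arc φ ⁅e j, y⁆) := by
      intro x y
      have := congrArg (SymmetricAlgebra.lift (arc φ)) (det_bracketMatrix_mul e hcard h0 x y)
      simp only [map_mul, map_sum, SymmetricAlgebra.lift_ι_apply] at this
      rw [this]
      refine Finset.sum_congr rfl fun i _ => Finset.sum_congr rfl fun j _ => ?_
      rw [← lie_skew x (e i), map_neg]
      ring
    have hsplit : ∀ k l : ℕ, D * (PowerSeries.X ^ (N - k) * PowerSeries.X ^ (N - l) *
        arc φ ⁅coeff (k : ℤ) a, coeff (l : ℤ) b⁆) =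
        ∑ i, ∑ j, -(PowerSeries.X ^ (N - k) * arc φ ⁅e i, coeff (k : ℤ) a⁆ *
          SymmetricAlgebra.lift (arc φ) ((bracketMatrix K e).adjugate i j) *
          (PowerSeries.X ^ (N - l) * arc φ ⁅e j, coeff (l : ℤ) b⁆)) := by
      intro k l
      rw [mul_left_comm, hid, Finset.mul_sum]
      refine Finset.sum_congr rfl fun i _ => ?_
      rw [Finset.mul_sum]
      refine Finset.sum_congr rfl fun j _ => ?_
      ring
    simp only [Finset.mul_sum, hsplit, A, B, Finset.sum_mul, ← Finset.sum_neg_distrib]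
    calc _ = ∑ k ∈ s, ∑ i, ∑ l ∈ s, ∑ j, _ := Finset.sum_congr rfl fun k _ => Finset.sum_comm
      _ = ∑ i, ∑ k ∈ s, ∑ l ∈ s, ∑ j, _ := Finset.sum_comm
      _ = ∑ i, ∑ k ∈ s, ∑ j, ∑ l ∈ s, _ := Finset.sum_congr rfl fun i _ =>
        Finset.sum_congr rfl fun k _ => Finset.sum_comm
      _ = ∑ i, ∑ j, ∑ k ∈ s, ∑ l ∈ s, _ := Finset.sum_congr rfl fun i _ => Finset.sum_comm
      _ = _ := Finset.sum_congr rfl fun i _ => Finset.sum_congr rfl fun j _ => Finset.sum_comm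
  have hdvd : (PowerSeries.X : PowerSeries K) ^ (2 * N + 1) ∣
      ∑ k ∈ s, ∑ l ∈ s, PowerSeries.X ^ (N - k) * PowerSeries.X ^ (N - l) *
        arc φ ⁅coeff (k : ℤ) a, coeff (l : ℤ) b⁆ := by
    rw [← hDunit.dvd_mul_left, key]
    refine Finset.dvd_sum fun i _ => Finset.dvd_sum fun j _ => ?_
    rw [dvd_neg]
    refine (pow_dvd_pow _ (by omega : 2 * N + 1 ≤ (N + 1) + (N + 1))).trans ?_
    rw [pow_add]
    exact mul_dvd_mul ((hA (e i)).mul_right _) (hB (e j))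
  rw [← coeff_sum_sum φ haN hbN]
  exact PowerSeries.X_pow_dvd_iff.mp hdvd _ (by omega)

end Loop

/-! ### Averaging over a cyclic group -/

section Average

variable {K : Type*} [Field K] {V : Type*} [AddCommGroup V] [Module K V]

/-- The average of the first `m` powers of an endomorphism. -/
def average (T : Module.End K V) (m : ℕ) : Module.End K V :=
  (m : K)⁻¹ • ∑ j ∈ Finset.range m, T ^ j

theorem average_apply (T : Module.End K V) (m : ℕ) (v : V) :
    average T m v = (m : K)⁻¹ • ∑ j ∈ Finset.range m, (T ^ j) v := by
  simp [average]

theorem mul_average {T : Module.End K V} {m : ℕ} (hT : T ^ m = 1) :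
    T * average T m = average T m := by
  rw [average, mul_smul_comm, Finset.mul_sum]
  congr 1
  -- Multiplying by T shifts the exponents from 0, …, m-1 to 1, …, m, and T^m = T^0.
  have h := Finset.sum_range_succ' (fun j => T ^ j) m
  rw [Finset.sum_range_succ, hT, pow_zero] at h
  simpa only [pow_succ'] using (add_right_cancel h).symm

theorem average_apply_of_fixed [CharZero K] {T : Module.End K V} {m : ℕ} (hm : 0 < m) {v : V}
    (hv : T v = v) : average T m v = v := by
  have hpow : ∀ j, (T ^ j) v = v := by
    intro j
    induction j with
    | zero => simp
    | succ j ih => rw [pow_succ, Module.End.mul_apply, hv, ih]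
  have hm' : (m : K) ≠ 0 := by exact_mod_cast hm.ne'
  rw [average_apply]
  simp only [hpow, Finset.sum_const, Finset.card_range]
  rw [← Nat.cast_smul_eq_nsmul K, smul_smul, inv_mul_cancel₀ hm', one_smul]

/-- The component of the average complementary to the fixed vectors lies in the sum of the
nontrivial eigenspaces. -/
theorem sub_average_mem [CharZero K] {T : Module.End K V} {m : ℕ} (hm : 0 < m) (hT : T ^ m = 1)
    {ζ : K} (hζ : IsPrimitiveRoot ζ m) (v : V) :
    v - average T m v ∈ ⨆ i ∈ Finset.Ico 1 m, Module.End.eigenspace T (ζ ^ i) := by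
  have hm' : (m : K) ≠ 0 := by exact_mod_cast hm.ne'
  have hζ0 : ζ ≠ 0 := hζ.ne_zero hm.ne'
  -- Averaging ζ^(-i) T, whose m-th power is again 1, projects onto the ζ^i-eigenspace.
  let p : ℕ → V := fun i => average ((ζ ^ i)⁻¹ • T) m v
  have hp : ∀ i, T (p i) = ζ ^ i • p i := by
    intro i
    have hpow : ((ζ ^ i)⁻¹ • T) ^ m = 1 := by
      rw [smul_pow, hT, inv_pow, ← pow_mul, mul_comm, pow_mul, hζ.pow_eq_one, one_pow, inv_one,
        one_smul]
    have h := LinearMap.congr_fun (mul_average hpow) v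
    change (ζ ^ i)⁻¹ • T (p i) = p i at h
    rw [← h, smul_smul, mul_inv_cancel₀ (pow_ne_zero _ hζ0), one_smul, h]
  have hsum : ∑ i ∈ Finset.range m, p i = v := by
    simp only [p, average_apply, ← Finset.smul_sum]
    rw [Finset.sum_comm]
    -- Orthogonality of characters: the powers of ζ^(-j) sum to zero unless j = 0.
    have hj : ∀ j ∈ Finset.range m, ∑ i ∈ Finset.range m, (((ζ ^ i)⁻¹ • T) ^ j) v =
        if j = 0 then (m : K) • v else 0 := by
      intro j hj
      have : ∀ i, (((ζ ^ i)⁻¹ • T) ^ j) v = ((ζ⁻¹ ^ j) ^ i) • (T ^ j) v := by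
        intro i
        rw [smul_pow, LinearMap.smul_apply, ← inv_pow, ← pow_mul, ← pow_mul, mul_comm]
      simp only [this, ← Finset.sum_smul]
      split_ifs with h
      · subst h; simp
      · have hne : ζ⁻¹ ^ j ≠ 1 :=
          hζ.inv.pow_ne_one_of_pos_of_lt h (Finset.mem_range.mp hj)
        rw [geom_sum_eq hne, ← pow_mul, mul_comm, pow_mul, hζ.inv.pow_eq_one, one_pow, sub_self,
          zero_div, zero_smul]
    rw [Finset.sum_congr rfl hj, Finset.sum_ite_eq', if_pos (Finset.mem_range.mpr hm), smul_smul,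
      inv_mul_cancel₀ hm', one_smul]
  have hp0 : p 0 = average T m v := by simp [p]
  have hv : v - average T m v = ∑ i ∈ Finset.Ico 1 m, p i := by
    rw [← hp0, sub_eq_iff_eq_add', ← hsum, Finset.range_eq_Ico,
      Finset.sum_eq_sum_Ico_succ_bot hm]
  rw [hv]
  exact Submodule.sum_mem _ fun i hi =>
    Submodule.mem_iSup_of_mem i (Submodule.mem_iSup_of_mem hi
      (Module.End.mem_eigenspace_iff.mpr (hp i)))

end Average

/-! ### Projection onto the twisted current algebra -/

section Loop

variable {K : Type*} [Field K] {q : Type*} [LieRing q] [LieAlgebra K q]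

/-- `Θ` as a linear endomorphism of the loop algebra. -/
def loopEnd (ζ : Kˣ) (θ : q ≃ₗ⁅K⁆ q) : Module.End K (Loop K q) :=
  (loopAut ζ θ : Loop K q →ₗ[K] Loop K q)

theorem coeff_loopEnd_pow (ζ : Kˣ) (θ : q ≃ₗ⁅K⁆ q) (j : ℕ) (k : ℤ) (f : Loop K q) :
    coeff k ((loopEnd ζ θ ^ j) f) = ((ζ ^ k : Kˣ) : K) ^ j •
      (((θ.toLinearEquiv : q →ₗ[K] q) : Module.End K q) ^ j) (coeff k f) := by
  induction j generalizing f with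
  | zero => simp
  | succ j ih =>
    rw [pow_succ', pow_succ', pow_succ', Module.End.mul_apply, Module.End.mul_apply, mul_smul]
    change coeff k (loopAut ζ θ _) = _
    rw [coeff_loopAut, ih, ← LieEquiv.coe_toLinearEquiv, map_smul]
    rfl

theorem end_pow_orderOf {θ : q ≃ₗ⁅K⁆ q} {m : ℕ} (hθ : orderOf θ.toLinearEquiv = m) :
    ((θ.toLinearEquiv : q →ₗ[K] q) : Module.End K q) ^ m = 1 := by
  have h : θ.toLinearEquiv ^ m = 1 := hθ ▸ pow_orderOf_eq_one _
  have := congrArg (LinearEquiv.automorphismGroup.toLinearMapMonoidHom) h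
  rw [map_pow, map_one] at this
  exact this

theorem loopEnd_pow {ζ : Kˣ} {θ : q ≃ₗ⁅K⁆ q} {m : ℕ} (hθ : orderOf θ.toLinearEquiv = m)
    (hζ : IsPrimitiveRoot ζ m) : loopEnd ζ θ ^ m = 1 := by
  ext f : 1
  apply loop_ext
  intro k
  rw [coeff_loopEnd_pow, end_pow_orderOf hθ, ← Units.val_pow_eq_pow_val, ← zpow_natCast,
    ← zpow_mul, mul_comm, zpow_mul, zpow_natCast, hζ.pow_eq_one, one_zpow]
  simp

theorem average_mem_twistedLoop {ζ : Kˣ} {θ : q ≃ₗ⁅K⁆ q} {m : ℕ}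
    (hT : loopEnd ζ θ ^ m = 1) (f : Loop K q) :
    average (loopEnd ζ θ) m f ∈ twistedLoop ζ θ :=
  LinearMap.congr_fun (mul_average hT) f

/-- Each power of Θ is a Lie homomorphism fixing g. -/
theorem average_lie {ζ : Kˣ} {θ : q ≃ₗ⁅K⁆ q} (m : ℕ) (f : Loop K q) {g : Loop K q}
    (hg : g ∈ twistedLoop ζ θ) :
    average (loopEnd ζ θ) m ⁅f, g⁆ = ⁅average (loopEnd ζ θ) m f, g⁆ := by
  have hpow : ∀ j, (loopEnd ζ θ ^ j) ⁅f, g⁆ = ⁅(loopEnd ζ θ ^ j) f, g⁆ := by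
    intro j
    induction j with
    | zero => simp
    | succ j ih =>
      rw [pow_succ', Module.End.mul_apply, Module.End.mul_apply, ih]
      change loopAut ζ θ _ = _
      rw [LieHom.map_lie, show loopAut ζ θ g = g from hg]
      rfl
  simp only [average_apply, hpow, smul_lie, sum_lie]

theorem coeff_average (ζ : Kˣ) (θ : q ≃ₗ⁅K⁆ q) (m : ℕ) (k : ℤ) (f : Loop K q) :
    coeff k (average (loopEnd ζ θ) m f) =
      average (((ζ ^ k : Kˣ) : K) • (θ.toLinearEquiv : q →ₗ[K] q)) m (coeff k f) := by
  simp only [average_apply, map_smul, map_sum, coeff_loopEnd_pow, smul_pow, LinearMap.smul_apply]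

theorem projPlus_of_mem {f : Loop K q} (hf : f ∈ currentPlus K q) : projPlus K q f = f := by
  apply loop_ext
  intro k
  rw [coeff_projPlus]
  split_ifs with h
  · rfl
  · exact (hf k (by omega)).symm

/-- The projection of `q[t, t⁻¹]` onto `q[t]^Θ`. -/
def twistedProj (ζ : Kˣ) (θ : q ≃ₗ⁅K⁆ q) (m : ℕ) (hT : loopEnd ζ θ ^ m = 1) :
    Loop K q →ₗ[K] twistedPlus ζ θ :=
  (projPlus K q ∘ₗ average (loopEnd ζ θ) m).codRestrict (twistedPlus ζ θ).toSubmodule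
    fun f => projPlus_mem ζ θ (average_mem_twistedLoop hT f)

theorem coe_twistedProj {ζ : Kˣ} {θ : q ≃ₗ⁅K⁆ q} {m : ℕ} (hT : loopEnd ζ θ ^ m = 1)
    (f : Loop K q) :
    (twistedProj ζ θ m hT f : Loop K q) = projPlus K q (average (loopEnd ζ θ) m f) := rfl

theorem twistedProj_coe [CharZero K] {ζ : Kˣ} {θ : q ≃ₗ⁅K⁆ q} {m : ℕ} (hm : 0 < m)
    (hT : loopEnd ζ θ ^ m = 1) (f : twistedPlus ζ θ) :
    twistedProj ζ θ m hT f = f := by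
  apply Subtype.ext
  rw [coe_twistedProj, average_apply_of_fixed (T := loopEnd ζ θ) hm f.2.2, projPlus_of_mem f.2.1]

theorem twistedProj_monomial_of_neg {ζ : Kˣ} {θ : q ≃ₗ⁅K⁆ q} {m : ℕ}
    (hT : loopEnd ζ θ ^ m = 1) {k : ℤ} (hk : k < 0) (x : q) :
    twistedProj ζ θ m hT (monomial k x) = 0 := by
  apply Subtype.ext
  apply loop_ext
  intro l
  rw [coe_twistedProj, coeff_projPlus, coeff_average, coeff_monomial]
  split_ifs with h1 h2
  · omega
  · simp
  · simp

/-- This extends invariance from q[t⁻¹]^Θ to all of q[t⁻¹]: bracketing with a Θ-fixed element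
commutes with averaging, so x may be replaced by its average. -/
theorem twistedProj_lie {ζ : Kˣ} {θ : q ≃ₗ⁅K⁆ q} {m : ℕ} (hT : loopEnd ζ θ ^ m = 1)
    {x : Loop K q} (hx : x ∈ currentMinus K q) :
    ∃ x' : twistedMinus ζ θ, ∀ a : twistedPlus ζ θ,
      twistedProj ζ θ m hT ⁅x, (a : Loop K q)⁆ = minusAction ζ θ x' a := by
  refine ⟨⟨average (loopEnd ζ θ) m x, ?_, average_mem_twistedLoop hT x⟩, fun a => ?_⟩
  · intro k hk
    rw [coeff_average, hx k hk, map_zero]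
  · apply Subtype.ext
    rw [coe_twistedProj, average_lie m x a.2.2]
    rfl

/-- Two invariants Poisson-commute at every functional whose constant coefficient is regular. -/
theorem lift_poissonBracket_eq_zero [CharZero K] [FiniteDimensional K q]
    {ζ : Kˣ} {θ : q ≃ₗ⁅K⁆ q} {m : ℕ} (hm : 0 < m) (hT : loopEnd ζ θ ^ m = 1)
    (φ : twistedPlus ζ θ →ₗ[K] K) {ι : Type*} [Fintype ι] [DecidableEq ι] (e : ι → q)
    (hcard : Fintype.card ι + lieIndex K q = Module.finrank K q)
    (hdet : (Matrix.of fun i j => φ (twistedProj ζ θ m hT (monomial 0 ⁅e i, e j⁆))).det ≠ 0)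
    {F G : SymmetricAlgebra K (twistedPlus ζ θ)}
    (hF : F ∈ twistedInvariants ζ θ) (hG : G ∈ twistedInvariants ζ θ) :
    SymmetricAlgebra.lift φ (poissonBracket F G) = 0 := by
  obtain ⟨a, ha⟩ := exists_differential φ F
  obtain ⟨b, hb⟩ := exists_differential φ G
  have hbracket : SymmetricAlgebra.lift φ (poissonBracket F G) = φ ⁅a, b⁆ := by
    rw [poissonBracket, hb]
    -- Since {F, y} = -(ad y)(F), the value is -φ([b,a]).
    change SymmetricAlgebra.lift φ (-adDerivation b F) = _
    rw [map_neg, adDerivation, ha]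
    simp [← map_neg]
  have hinv : ∀ {H : SymmetricAlgebra K (twistedPlus ζ θ)} {c : twistedPlus ζ θ},
      H ∈ twistedInvariants ζ θ →
      (∀ f : twistedPlus ζ θ →ₗ[K] SymmetricAlgebra K (twistedPlus ζ θ),
        SymmetricAlgebra.lift φ (extendDerivation f H) = SymmetricAlgebra.lift φ (f c)) →
      ∀ x ∈ currentMinus K q, (φ ∘ₗ twistedProj ζ θ m hT) ⁅x, (c : Loop K q)⁆ = 0 := by
    intro H c hH hc x hx
    obtain ⟨x', hx'⟩ := twistedProj_lie hT hx
    have h := hc (SymmetricAlgebra.ι K (twistedPlus ζ θ) ∘ₗ minusAction ζ θ x')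
    rw [hH x', map_zero, LinearMap.comp_apply, SymmetricAlgebra.lift_ι_apply] at h
    rw [LinearMap.comp_apply, hx', ← h]
  have hzero := apply_lie_eq_zero (φ ∘ₗ twistedProj ζ θ m hT)
    (fun k hk x => by
      rw [LinearMap.comp_apply, twistedProj_monomial_of_neg hT hk, map_zero])
    e hcard hdet a.2.1 b.2.1 (hinv hF ha) (hinv hG hb)
  rw [LinearMap.comp_apply, ← LieSubalgebra.coe_bracket, twistedProj_coe hm] at hzero
  rw [hbracket, hzero]

end Loop

end TwistedCurrent

end

/-! ### Density of the functionals with regular constant term -/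

theorem mainTheorem2 {K : Type*} [Field K] [IsAlgClosed K] [CharZero K]
    {q : Type*} [LieRing q] [LieAlgebra K q] [FiniteDimensional K q]
    (θ : q ≃ₗ⁅K⁆ q) (m : ℕ) (hm : 0 < m) (hθ : orderOf θ.toLinearEquiv = m)
    (ζ : Kˣ) (hζ : IsPrimitiveRoot ζ m)
    (hreg : ∃ ξ ∈ TwistedCurrent.fixedDual ζ m θ, ξ ∈ TwistedCurrent.regularDual K q) :
    ∀ F ∈ TwistedCurrent.twistedInvariants ζ θ, ∀ G ∈ TwistedCurrent.twistedInvariants ζ θ,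
      TwistedCurrent.poissonBracket F G = 0 := by
  open TwistedCurrent in
  intro F hF G hG
  obtain ⟨ξ, hξ, hξreg⟩ := hreg
  have hT := loopEnd_pow hθ hζ
  obtain ⟨r, e, hr, hdet⟩ := exists_det_ne_zero ξ
  have hcard : Fintype.card (Fin r) + lieIndex K q = Module.finrank K q := by
    rw [Fintype.card_fin, ← hr, show Module.finrank K (coadjointStabilizer K q ξ) = _ from hξreg]
  let constant : q →ₗ[K] twistedPlus ζ θ :=
    { toFun := fun x => twistedProj ζ θ m hT (monomial 0 x)
      map_add' := fun x y => by rw [monomial_add, map_add]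
      map_smul' := fun c x => by rw [monomial_smul, map_smul, RingHom.id_apply] }
  -- The minor of q, pulled back along q → q_0 ⊂ q[t]^Θ to a function on the dual of q[t]^Θ.
  let Δ := SymmetricAlgebra.lift (SymmetricAlgebra.ι K (twistedPlus ζ θ) ∘ₗ constant)
    (bracketMatrix K e).det
  have hΔ : ∀ φ : twistedPlus ζ θ →ₗ[K] K, SymmetricAlgebra.lift φ Δ =
      (Matrix.of fun i j => φ (twistedProj ζ θ m hT (monomial 0 ⁅e i, e j⁆))).det := by
    intro φ
    simp only [Δ]
    rw [lift_det_bracketMatrix, AlgHom.map_det]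
    congr 1
    ext i j
    simp [constant]
  have hΔ0 : Δ ≠ 0 := by
    intro h
    -- Evaluating ξ on the constant coefficient gives a point where Δ ≠ 0: since ξ kills the
    -- nontrivial eigenspaces, it does not change under averaging.
    let φ : twistedPlus ζ θ →ₗ[K] K :=
      ξ ∘ₗ coeff 0 ∘ₗ (twistedPlus ζ θ).toSubmodule.subtype
    have hφ : ∀ x, φ (twistedProj ζ θ m hT (monomial 0 x)) = ξ x := by
      intro x
      change ξ (coeff 0 (projPlus K q (average (loopEnd ζ θ) m (monomial 0 x)))) = ξ x
      rw [coeff_projPlus, if_pos le_rfl, coeff_average, coeff_monomial, if_pos rfl, zpow_zero,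
        Units.val_one, one_smul, eq_comm, ← sub_eq_zero, ← map_sub]
      exact (Submodule.mem_dualAnnihilator ξ).mp hξ _
        (sub_average_mem hm (end_pow_orderOf hθ) (IsPrimitiveRoot.coe_units_iff.mpr hζ) x)
    have h' := hΔ φ
    simp only [hφ, h, map_zero] at h'
    exact hdet h'.symm
  have hprod : Δ * poissonBracket F G = 0 := by
    apply eq_zero_of_forall_lift_eq_zero
    intro φ
    rw [map_mul]
    by_cases h : SymmetricAlgebra.lift φ Δ = 0
    · rw [h, zero_mul]
    · rw [hΔ] at h
      rw [lift_poissonBracket_eq_zero hm hT φ e hcard h hF hG, mul_zero]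
  exact (mul_eq_zero.mp hprod).resolve_left hΔ0
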